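/- Let $A\in\mathbb R^{k\times n}$ with $n\ge 1$, $y\in\mathbb R^k$, $\delta\ge 0$, $\lambda\ge 0$ and $\mu>0$. Write $\mathbf 1\in\mathbb R^n$ for the all-ones vector, $B(y,\delta)=\{z\in\mathbb R^k:\|z-y\|_2\le\delta\}$, and $\iota_S$ for the function that is $0$ on $S$ and $+\infty$ off $S$. Vector inequalities and maxima are componentwise. A minimizer of an extended-real-valued function is a point where the least value is attained and is finite. Consider the problems $$(\mathrm{CBPDN})\quad \min_{x}\ \|x\|_1\quad\text{subject to } \|Ax-y\|_2\le\delta,\ x\ge 0,\ \mathbf 1^Tx=1,$$ $$(\mathrm{CBP})\quad \min_{x}\ \|x\|_1\quad\text{subject to } Ax=y,\ x\ge 0,\ \mathbf 1^Tx=1.$$ Put $$f_1(x)=\iota_{\{1\}}(\mathbf 1^Tx),\qquad f_2(u)=\iota_{B(y,\delta)}(u_1)+\lambda\|u_2\|_1+\iota_{\mathbb R^n_+}(u_2)\quad (u=(u_1,u_2)\in\mathbb R^k\times\mathbb R^n),\qquad G=\begin{bmatrix}A\\ I\end{bmatrix},$$ $$M=A^TA+I,\qquad c=M^{-1}\mathbf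 1(\mathbf 1^TM^{-1}\mathbf 1)^{-1},$$ $$\psi(\nu)=\nu\ \text{ if }\|\nu-y\|_2\le\delta,\qquad \psi(\nu)=y+\delta\,\frac{\nu-y}{\|\nu-y\|_2}\ \text{ otherwise,}$$ and $\operatorname{soft}(\nu,\tau)_i=\operatorname{sign}(\nu_i)\max\{|\nu_i|-\tau,0\}$. Given arbitrary $u_{1,0},d_{1,0}\in\mathbb R^k$ and $u_{2,0},d_{2,0}\in\mathbb R^n$, C-SUnSAL computes, for $j=0,1,2,\dots$, $$\begin{aligned} w_j&=A^T(u_{1,j}+d_{1,j})+(u_{2,j}+d_{2,j}),\\ x_{j+1}&=M^{-1}w_j-c\,(\mathbf 1^TM^{-1}w_j-1),\\ u_{1,j+1}&=\psi(Ax_{j+1}-d_{1,j}),\\ u_{2,j+1}&=\max\{0,\operatorname{soft}(x_{j+1}-d_{2,j},\lambda/\mu)\},\\ d_{1,j+1}&=d_{1,j}-(Ax_{j+1}-u_{1,j+1}),\\ d_{2,j+1}&=d_{2,j}-(x_{j+1}-u_{2,j+1}). \end{aligned}$$ Then the following hold. 1. The solutions of CBPDN are exactly the minimizers of $f_1(x)+f_2(Gx)$,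 and the solutions of CBP are exactly those of CBPDN with $\delta=0$. If CBPDN is feasible, it has a solution. 2. $f_1$ and $f_2$ are closed, proper and convex, and $G$ has full column rank. 3. $M$ is invertible, $\mathbf 1^TM^{-1}\mathbf 1\ne 0$, and for all $u=(u_1,u_2)$, $d=(d_1,d_2)$ the unique minimizer of $x\mapsto f_1(x)+\frac\mu2\|Gx-u-d\|_2^2$ is $M^{-1}w-c(\mathbf 1^TM^{-1}w-1)$ with $w=A^T(u_1+d_1)+(u_2+d_2)$. 4. For every $\nu\in\mathbb R^k$, $\psi(\nu)$ is the unique minimizer of $\frac12\|u-\nu\|_2^2+\iota_{B(y,\delta)}(u)$. For every $\nu\in\mathbb R^n$, $\max\{0,\operatorname{soft}(\nu,\lambda/\mu)\}$ is the unique minimizer of $\frac12\|u-\nu\|_2^2+\frac\lambda\mu\|u\|_1+\iota_{\mathbb R^n_+}(u)$. For all $x$ and $d=(d_1,d_2)$, the unique minimizer of $u\mapsto f_2(u)+\frac\mu2\|Gx-u-d\|_2^2$ is $\bigl(\psi(Ax-d_1),\max\{0,\operatorname{soft}(x-d_2,\lambda/\mu)\}\bigr)$. 5. Sequences $x_j$,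 $u_j=(u_{1,j},u_{2,j})$, $d_j=(d_{1,j},d_{2,j})$ are generated by C-SUnSAL if and only if they satisfy the ADMM recursion for $f_1,f_2,G,\mu$: for all $j\ge 0$, $x_{j+1}$ minimizes $f_1(x)+\frac\mu2\|Gx-u_j-d_j\|_2^2$, $u_{j+1}$ minimizes $f_2(u)+\frac\mu2\|Gx_{j+1}-u-d_j\|_2^2$, and $d_{j+1}=d_j-(Gx_{j+1}-u_{j+1})$. 6. If CBPDN has a solution, then for every initialization the C-SUnSAL sequence $(x_j)$ converges to a solution of CBPDN. In particular, if $\delta=0$ and CBP has a solution, $(x_j)$ converges to a solution of CBP. -/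

import Mathlib

open Filter Topology Matrix

noncomputable section

/-! Vectors are plain functions `ι → ℝ`; since the norm instance on that type is the sup norm, the
`ℓ₁` and `ℓ₂` norms are written out. The topology of `ι → ℝ` is the Euclidean one. -/

/-- The `ℓ₂` norm of a vector. -/
def l2norm {ι : Type*} [Fintype ι] (v : ι → ℝ) : ℝ := Real.sqrt (∑ i, v i ^ 2)

/-- The `ℓ₁` norm of a vector. -/
def l1norm {ι : Type*} [Fintype ι] (v : ι → ℝ) : ℝ := ∑ i, |v i|

open Classical in
/-- The convex-analytic indicator `ι_S`: `0` on `S` and `+∞` off `S`. -/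
def indic {E : Type*} (S : Set E) (x : E) : EReal := if x ∈ S then 0 else ⊤

/-- The set of minimizers of an extended-real-valued function; as usual, a function that is
identically `+∞` has none. -/
def argminSet {E : Type*} (F : E → EReal) : Set E := {x | F x ≠ ⊤ ∧ ∀ z, F x ≤ F z}

/-- Closed proper convex functions, through the epigraph. -/
structure IsClosedProperConvex {E : Type*} [AddCommGroup E] [Module ℝ E] [TopologicalSpace E]
    (f : E → EReal) : Prop where
  ne_bot : ∀ x, f x ≠ ⊥
  ne_top : ∃ x, f x ≠ ⊤
  convex_epigraph : Convex ℝ {p : E × ℝ | f p.1 ≤ (p.2 : EReal)}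
  closed_epigraph : IsClosed {p : E × ℝ | f p.1 ≤ (p.2 : EReal)}

/-- The closed Euclidean ball `B(y, δ)`. -/
def l2ball {k : ℕ} (y : Fin k → ℝ) (δ : ℝ) : Set (Fin k → ℝ) := {z | l2norm (z - y) ≤ δ}

/-- The nonnegative orthant. -/
def orthant (n : ℕ) : Set (Fin n → ℝ) := {v | ∀ i, 0 ≤ v i}

/-! ### The optimization problems -/

/-- The constraint set of CBPDN. -/
def cbpdnFeasible {k n : ℕ} (A : Matrix (Fin k) (Fin n) ℝ) (y : Fin k → ℝ) (δ : ℝ) :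
    Set (Fin n → ℝ) :=
  {x | l2norm (A *ᵥ x - y) ≤ δ ∧ (∀ i, 0 ≤ x i) ∧ ∑ i, x i = 1}

/-- The solutions of CBPDN: minimizers of the `ℓ₁` norm over the constraint set. -/
def cbpdnSolutions {k n : ℕ} (A : Matrix (Fin k) (Fin n) ℝ) (y : Fin k → ℝ) (δ : ℝ) :
    Set (Fin n → ℝ) :=
  {x | x ∈ cbpdnFeasible A y δ ∧ IsMinOn l1norm (cbpdnFeasible A y δ) x}

/-- The constraint set of CBP. -/
def cbpFeasible {k n : ℕ} (A : Matrix (Fin k) (Fin n) ℝ) (y : Fin k → ℝ) : Set (Fin n → ℝ) :=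
  {x | A *ᵥ x = y ∧ (∀ i, 0 ≤ x i) ∧ ∑ i, x i = 1}

/-- The solutions of CBP. -/
def cbpSolutions {k n : ℕ} (A : Matrix (Fin k) (Fin n) ℝ) (y : Fin k → ℝ) : Set (Fin n → ℝ) :=
  {x | x ∈ cbpFeasible A y ∧ IsMinOn l1norm (cbpFeasible A y) x}

/-! ### ADMM -/

/-- The objective of the first ADMM step, `f₁(x) + (μ/2) ‖G x - u - d‖₂²`. -/
def admmObjX {p n : Type*} [Fintype p] [Fintype n] (f₁ : (n → ℝ) → EReal) (G : Matrix p n ℝ)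
    (μ : ℝ) (u d : p → ℝ) (x : n → ℝ) : EReal :=
  f₁ x + ((μ / 2 * l2norm (G *ᵥ x - u - d) ^ 2 : ℝ) : EReal)

/-- The objective of the second ADMM step, `f₂(u) + (μ/2) ‖G x - u - d‖₂²`. -/
def admmObjU {p n : Type*} [Fintype p] [Fintype n] (f₂ : (p → ℝ) → EReal) (G : Matrix p n ℝ)
    (μ : ℝ) (x : n → ℝ) (d : p → ℝ) (u : p → ℝ) : EReal :=
  f₂ u + ((μ / 2 * l2norm (G *ᵥ x - u - d) ^ 2 : ℝ) : EReal)

/-- The sequences `x`, `u`, `d` satisfy the ADMM recursion for `min f₁(x) + f₂(G x)`.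
The entries `u 0`, `d 0` are the initialization; `x 0` plays no role. -/
structure IsADMM {p n : Type*} [Fintype p] [Fintype n] (f₁ : (n → ℝ) → EReal)
    (f₂ : (p → ℝ) → EReal) (G : Matrix p n ℝ) (μ : ℝ)
    (x : ℕ → n → ℝ) (u d : ℕ → p → ℝ) : Prop where
  x_step : ∀ j, x (j + 1) ∈ argminSet (admmObjX f₁ G μ (u j) (d j))
  u_step : ∀ j, u (j + 1) ∈ argminSet (admmObjU f₂ G μ (x (j + 1)) (d j))
  d_step : ∀ j, d (j + 1) = d j - (G *ᵥ x (j + 1) - u (j + 1))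

/-! ### The ADMM splitting of CBPDN -/

/-- `f₁(x) = ι_{1}(1ᵀx)`. -/
def csF1 {n : ℕ} (x : Fin n → ℝ) : EReal := indic {(1 : ℝ)} (∑ i, x i)

/-- `f₂(u) = ι_{B(y,δ)}(u₁) + lam ‖u₂‖₁ + ι_{ℝ₊ⁿ}(u₂)`, for `u = (u₁, u₂)`. -/
def csF2 {k n : ℕ} (y : Fin k → ℝ) (δ lam : ℝ) (u : Fin k ⊕ Fin n → ℝ) : EReal :=
  indic (l2ball y δ) (u ∘ Sum.inl) + ((lam * l1norm (u ∘ Sum.inr) : ℝ) : EReal)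
    + indic (orthant n) (u ∘ Sum.inr)

/-- `G = [Aᵀ I]ᵀ`: the matrix `A` stacked on top of the identity. -/
def csG {k n : ℕ} (A : Matrix (Fin k) (Fin n) ℝ) : Matrix (Fin k ⊕ Fin n) (Fin n) ℝ :=
  Matrix.fromRows A 1

/-! ### The C-SUnSAL algorithm -/

/-- `B = AᵀA + I`. -/
def csB {k n : ℕ} (A : Matrix (Fin k) (Fin n) ℝ) : Matrix (Fin n) (Fin n) ℝ := Aᵀ * A + 1

/-- `C = B⁻¹ 1 (1ᵀ B⁻¹ 1)⁻¹`. -/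
def csC {k n : ℕ} (A : Matrix (Fin k) (Fin n) ℝ) : Fin n → ℝ :=
  ((1 : Fin n → ℝ) ⬝ᵥ (csB A)⁻¹ *ᵥ 1)⁻¹ • ((csB A)⁻¹ *ᵥ 1)

/-- The update `x ← B⁻¹ w - C (1ᵀ B⁻¹ w - 1)` with
`w = Aᵀ (u₁ + d₁) + (u₂ + d₂)`. -/
def csXUpdate {k n : ℕ} (A : Matrix (Fin k) (Fin n) ℝ) (u₁ d₁ : Fin k → ℝ) (u₂ d₂ : Fin n → ℝ) :
    Fin n → ℝ :=
  let w : Fin n → ℝ := Aᵀ *ᵥ (u₁ + d₁) + (u₂ + d₂)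
  (csB A)⁻¹ *ᵥ w - ((1 : Fin n → ℝ) ⬝ᵥ (csB A)⁻¹ *ᵥ w - 1) • csC A

open Classical in
/-- The projection `ψ_{B(y,δ)}` onto the closed ball, in closed form. -/
def ballProj {k : ℕ} (y : Fin k → ℝ) (δ : ℝ) (ν : Fin k → ℝ) : Fin k → ℝ :=
  if l2norm (ν - y) ≤ δ then ν else y + (δ / l2norm (ν - y)) • (ν - y)

/-- The scalar soft threshold `soft(a, τ) = sign(a) max{|a| - τ, 0}`. -/
def soft (a τ : ℝ) : ℝ := Real.sign a * max (|a| - τ) 0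

/-- Nonnegative soft thresholding `max{0, soft(ν, τ)}`, componentwise. -/
def nonnegSoft {n : ℕ} (ν : Fin n → ℝ) (τ : ℝ) : Fin n → ℝ := fun i => max 0 (soft (ν i) τ)

/-- The sequences are generated by C-SUnSAL. The entries `u₁ 0`, `d₁ 0`, `u₂ 0`, `d₂ 0` are the
arbitrary initialization; `x 0` plays no role. -/
structure IsCSUnSAL {k n : ℕ} (A : Matrix (Fin k) (Fin n) ℝ) (y : Fin k → ℝ) (δ lam μ : ℝ)
    (x : ℕ → Fin n → ℝ) (u₁ d₁ : ℕ → Fin k → ℝ) (u₂ d₂ : ℕ → Fin n → ℝ) : Prop where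
  x_step : ∀ j, x (j + 1) = csXUpdate A (u₁ j) (d₁ j) (u₂ j) (d₂ j)
  u₁_step : ∀ j, u₁ (j + 1) = ballProj y δ (A *ᵥ x (j + 1) - d₁ j)
  u₂_step : ∀ j, u₂ (j + 1) = nonnegSoft (x (j + 1) - d₂ j) (lam / μ)
  d₁_step : ∀ j, d₁ (j + 1) = d₁ j - (A *ᵥ x (j + 1) - u₁ (j + 1))
  d₂_step : ∀ j, d₂ (j + 1) = d₂ j - (x (j + 1) - u₂ (j + 1))

end

/-! On the constraint set the `ℓ₁` norm equals the coordinate sum, which is `1`. So every feasible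
point is a solution (`cbpdnSolutions_eq_feasible`), and convergence to a solution is a feasibility
question: find a point of `L ∩ C`, with `L = {G x : 1ᵀx = 1}` and `C` the domain of `f₂`.

On `C` the penalty is the linear form `lam * 1ᵀu₂`. Adding the constant vector `s = (0, (lam/μ) 1)`
to the scaled dual variable absorbs it, and since `s` is orthogonal to all differences of points of
`L`, the `x`-step is unaffected. After this shift ADMM alternates projections onto `L` and `C` with
a running correction `e`.

For these, `‖u - p‖² + ‖e - q‖²` decreases for every primal-dual pair `(p, q)` (`lyapunov_step`).
The pair `(p, 0)` with `p ∈ L ∩ C` is always available, so no constraint qualification is needed. It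
gives boundedness and `a - u → 0`. Any cluster point is again a primal-dual pair, and monotonicity
with respect to it forces convergence (`tendsto_of_alternating_projections`).

The closed forms of the updates follow from variational inequalities, which also supply the
hypotheses of the convergence theorem. -/

/-! ### Convergence of the projection iteration -/

section Projection

variable {E : Type*} [NormedAddCommGroup E] [InnerProductSpace ℝ E]

open scoped RealInnerProductSpace

/-- One step of the iteration decreases the squared distance to a primal-dual pair. -/
theorem lyapunov_step {us es a u e u' e' : E} (ha : ⟪a - u - e, us - a⟫ = 0)
    (hes : ⟪es, a - us⟫ = 0) (hu : 0 ≤ ⟪e', us - u'⟫) (hu' : 0 ≤ ⟪es, u' - us⟫)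
    (he : e' = e - (a - u')) :
    ‖u' - us‖ ^ 2 + ‖e' - es‖ ^ 2 ≤ ‖u - us‖ ^ 2 + ‖e - es‖ ^ 2 - ‖a - u‖ ^ 2 := by
  subst he
  simp only [← real_inner_self_eq_norm_sq, inner_sub_left, inner_sub_right] at *
  -- Once symmetric inner products are oriented alike, the claim is twice the sum of the four
  -- hypotheses.
  simp only [real_inner_comm a u, real_inner_comm a e, real_inner_comm a es,
    real_inner_comm a u', real_inner_comm u us,
    real_inner_comm e es, real_inner_comm e u',
    real_inner_comm us es, real_inner_comm us u', real_inner_comm es u'] at *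
  linarith

/-- The alternating direction iteration for a feasibility problem `L ∩ C ≠ ∅`, where `a j` is the
projection of `u j + e j` onto `L` and `u (j + 1)` the projection of `a j - e j` onto `C`,
converges to a point of `L ∩ C`. -/
theorem tendsto_of_alternating_projections [ProperSpace E] {L C : Set E} (hL : IsClosed L)
    (hC : IsClosed C) (hLC : (L ∩ C).Nonempty) {a u e : ℕ → E} (haL : ∀ j, a j ∈ L)
    (ha : ∀ j, ∀ z ∈ L, ⟪a j - u j - e j, z - a j⟫ = 0) (huC : ∀ j, u (j + 1) ∈ C)
    (hu : ∀ j, ∀ v ∈ C, 0 ≤ ⟪e (j + 1), v - u (j + 1)⟫)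
    (he : ∀ j, e (j + 1) = e j - (a j - u (j + 1))) :
    ∃ p ∈ L ∩ C, Tendsto a atTop (𝓝 p) := by
  obtain ⟨us, husL, husC⟩ := hLC
  have step : ∀ p ∈ L ∩ C, ∀ q : E, (∀ z ∈ L, ⟪q, z - p⟫ = 0) → (∀ v ∈ C, 0 ≤ ⟪q, v - p⟫) →
      ∀ j, ‖u (j + 1) - p‖ ^ 2 + ‖e (j + 1) - q‖ ^ 2 ≤
        ‖u j - p‖ ^ 2 + ‖e j - q‖ ^ 2 - ‖a j - u j‖ ^ 2 := fun p hp q hqL hqC j =>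
    lyapunov_step (ha j p hp.1) (hqL _ (haL j)) (hu j p hp.2) (hqC _ (huC j)) (he j)
  set V : E → E → ℕ → ℝ := fun p q j => ‖u j - p‖ ^ 2 + ‖e j - q‖ ^ 2 with hV
  have hV0 : ∀ p q j, 0 ≤ V p q j := fun p q j => by positivity
  have anti : ∀ p ∈ L ∩ C, ∀ q : E, (∀ z ∈ L, ⟪q, z - p⟫ = 0) → (∀ v ∈ C, 0 ≤ ⟪q, v - p⟫) →
      Antitone (V p q) := fun p hp q hqL hqC =>
    antitone_nat_of_succ_le fun j =>
      (step p hp q hqL hqC j).trans (sub_le_self _ (by positivity))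
  -- The zero dual vector pairs with any point of `L ∩ C`.
  have anti0 := anti us ⟨husL, husC⟩ 0 (by simp) (by simp)
  have lim0 := tendsto_atTop_ciInf anti0 ⟨0, by rintro _ ⟨j, rfl⟩; exact hV0 _ _ _⟩
  have hau : Tendsto (fun j => a j - u j) atTop (𝓝 0) := by
    rw [tendsto_zero_iff_norm_tendsto_zero]
    have h2 : Tendsto (fun j => ‖a j - u j‖ ^ 2) atTop (𝓝 0) := by
      -- Consecutive values of the convergent sequence `V` differ by at least `‖a j - u j‖²`.
      have hd := lim0.sub ((tendsto_add_atTop_iff_nat 1).2 lim0)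
      rw [sub_self] at hd
      refine squeeze_zero (fun j => by positivity) (fun j => ?_) hd
      have := step us ⟨husL, husC⟩ 0 (by simp) (by simp) j
      simp only [hV]
      linarith
    have := h2.sqrt
    simpa [Real.sqrt_sq] using this
  have hbdd : ∀ j, (u j, e j) ∈ Metric.closedBall us (√(V us 0 0)) ×ˢ
      Metric.closedBall (0 : E) (√(V us 0 0)) := fun j => by
    have h := anti0 (Nat.zero_le j)
    simp only [Set.mem_prod, Metric.mem_closedBall, dist_eq_norm]
    constructor <;> apply Real.le_sqrt_of_sq_le <;> refine le_trans ?_ h <;> simp only [hV]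
    · nlinarith [sq_nonneg ‖e j - 0‖]
    · nlinarith [sq_nonneg ‖u j - us‖]
  obtain ⟨⟨p, q⟩, -, φ, hφ, hlim⟩ := tendsto_subseq_of_bounded
    (Metric.isBounded_closedBall.prod Metric.isBounded_closedBall) hbdd
  have hup : Tendsto (u ∘ φ) atTop (𝓝 p) := (continuous_fst.tendsto _).comp hlim
  have heq : Tendsto (e ∘ φ) atTop (𝓝 q) := (continuous_snd.tendsto _).comp hlim
  have hauφ := hau.comp hφ.tendsto_atTop
  have hap : Tendsto (a ∘ φ) atTop (𝓝 p) := by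
    simpa [Function.comp_def] using hauφ.add hup
  -- Membership in `C` and the inequality for `e` are known only from index `1` on; `u 0` and `e 0`
  -- are arbitrary.
  have hφ1 : ∀ᶠ i in atTop, ∃ j, φ i = j + 1 := by
    filter_upwards [hφ.tendsto_atTop.eventually_ge_atTop 1] with i hi
    exact ⟨φ i - 1, by omega⟩
  have hpL : p ∈ L := hL.mem_of_tendsto hap (Eventually.of_forall fun i => haL _)
  have hpC : p ∈ C := hC.mem_of_tendsto hup (hφ1.mono fun i ⟨j, hj⟩ => by
    simpa [hj] using huC j)
  have hqL : ∀ z ∈ L, ⟪q, z - p⟫ = 0 := fun z hz => by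
    have h1 := (hauφ.sub heq).inner (𝕜 := ℝ) (tendsto_const_nhds (x := z) |>.sub hap)
    have h2 : ⟪(0 : E) - q, z - p⟫ = 0 :=
      tendsto_nhds_unique h1 (tendsto_const_nhds.congr fun i => (ha (φ i) z hz).symm)
    simpa using h2
  have hqC : ∀ v ∈ C, 0 ≤ ⟪q, v - p⟫ := fun v hv =>
    ge_of_tendsto (heq.inner (𝕜 := ℝ) (tendsto_const_nhds (x := v) |>.sub hup))
      (hφ1.mono fun i ⟨j, hj⟩ => by simpa [hj] using hu j v hv)
  -- With the cluster point itself as reference pair, `V` is monotone and tends to `0` along a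
  -- subsequence, hence tends to `0`.
  have antip := anti p ⟨hpL, hpC⟩ q hqL hqC
  have limp := tendsto_atTop_ciInf antip ⟨0, by rintro _ ⟨j, rfl⟩; exact hV0 _ _ _⟩
  have limφ : Tendsto (V p q ∘ φ) atTop (𝓝 0) := by
    have h := ((hup.sub_const p).norm.pow 2).add ((heq.sub_const q).norm.pow 2)
    simpa [hV, Function.comp_def] using h
  rw [tendsto_nhds_unique (limp.comp hφ.tendsto_atTop) limφ] at limp
  have hu0 : Tendsto (fun j => u j - p) atTop (𝓝 0) := by
    rw [tendsto_zero_iff_norm_tendsto_zero]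
    have h2 : Tendsto (fun j => ‖u j - p‖ ^ 2) atTop (𝓝 0) :=
      squeeze_zero (fun j => by positivity)
        (fun j => le_add_of_nonneg_right (sq_nonneg ‖e j - q‖)) limp
    simpa [Real.sqrt_sq] using h2.sqrt
  refine ⟨p, ⟨hpL, hpC⟩, ?_⟩
  have := (hau.add hu0).add_const p
  simpa using this

end Projection

/-! ### The written-out norms -/

section Norms

variable {ι : Type*} [Fintype ι]

theorem l2norm_eq_norm_toLp (v : ι → ℝ) : l2norm v = ‖WithLp.toLp 2 v‖ := by
  simp [l2norm, EuclideanSpace.norm_eq]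

theorem l2norm_sq (v : ι → ℝ) : l2norm v ^ 2 = v ⬝ᵥ v := by
  rw [l2norm, Real.sq_sqrt (Finset.sum_nonneg fun i _ => sq_nonneg _)]
  simp [dotProduct, sq]

theorem l2norm_nonneg (v : ι → ℝ) : 0 ≤ l2norm v := Real.sqrt_nonneg _

theorem dotProduct_le_l2norm_mul_l2norm (v w : ι → ℝ) : v ⬝ᵥ w ≤ l2norm v * l2norm w := by
  have h := real_inner_le_norm (WithLp.toLp 2 w) (WithLp.toLp 2 v)
  rw [EuclideanSpace.inner_toLp_toLp, ← l2norm_eq_norm_toLp, ← l2norm_eq_norm_toLp] at h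
  rw [mul_comm]
  simpa using h

theorem l2norm_eq_zero {v : ι → ℝ} : l2norm v = 0 ↔ v = 0 := by
  rw [l2norm_eq_norm_toLp, norm_eq_zero]
  simp

theorem l2norm_sub_sq_pos {v w : ι → ℝ} (h : v ≠ w) : 0 < l2norm (v - w) ^ 2 :=
  pow_pos ((l2norm_nonneg _).lt_of_ne' fun h0 => h (sub_eq_zero.1 (l2norm_eq_zero.1 h0))) 2

/-- Serves every uniqueness proof below: once a variational inequality controls the cross term, `‖v
- p‖²` is the strict excess of `v` over the minimizer `p`. -/
theorem l2norm_sub_sq_eq (v p w : ι → ℝ) :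
    l2norm (v - w) ^ 2 =
      l2norm (p - w) ^ 2 + l2norm (v - p) ^ 2 + 2 * ((p - w) ⬝ᵥ (v - p)) := by
  simp only [l2norm_sq, dotProduct_sub, sub_dotProduct, dotProduct_comm p v, dotProduct_comm w v,
    dotProduct_comm w p]
  ring

theorem l2norm_sub_comm (v w : ι → ℝ) : l2norm (v - w) = l2norm (w - v) := by
  simp [l2norm_eq_norm_toLp, norm_sub_rev]

theorem continuous_l2norm : Continuous (l2norm : (ι → ℝ) → ℝ) := by
  unfold l2norm
  fun_prop

theorem l1norm_eq_sum {v : ι → ℝ} (h : ∀ i, 0 ≤ v i) : l1norm v = ∑ i, v i :=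
  Finset.sum_congr rfl fun i _ => abs_of_nonneg (h i)

end Norms

/-! ### Indicators and minimizers -/

theorem indic_of_mem {E : Type*} {S : Set E} {x : E} (h : x ∈ S) : indic S x = 0 := if_pos h

theorem indic_of_notMem {E : Type*} {S : Set E} {x : E} (h : x ∉ S) : indic S x = ⊤ := if_neg h

theorem argminSet_eq_singleton {E : Type*} {F : E → EReal} {p : E} (hp : F p ≠ ⊤)
    (h : ∀ z, z ≠ p → F p < F z) : argminSet F = {p} := by
  ext x
  constructor
  · rintro ⟨-, hx⟩
    by_contra hne
    exact (h x hne).not_ge (hx p)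
  · rintro rfl
    refine ⟨hp, fun z => ?_⟩
    by_cases hz : z = x
    · rw [hz]
    · exact (h z hz).le

/-- A function that is finite exactly on `S` has the unique minimizer `p` if `p` is the strict
minimizer over `S`. -/
theorem argminSet_eq_singleton_of_real {E : Type*} {F : E → EReal} {S : Set E} {g : E → ℝ} {p : E}
    (hF : ∀ z ∈ S, F z = g z) (hF' : ∀ z ∉ S, F z = ⊤) (hp : p ∈ S)
    (h : ∀ z ∈ S, z ≠ p → g p < g z) : argminSet F = {p} := by
  refine argminSet_eq_singleton (by simp [hF p hp]) fun z hz => ?_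
  rw [hF p hp]
  by_cases hzS : z ∈ S
  · rw [hF z hzS]
    exact EReal.coe_lt_coe_iff.2 (h z hzS hz)
  · rw [hF' z hzS]
    exact EReal.coe_lt_top _

/-! ### The ball, the orthant and their proximal maps -/

section Prox

variable {k n : ℕ}

theorem convex_l2ball (y : Fin k → ℝ) (δ : ℝ) : Convex ℝ (l2ball y δ) := by
  have h := (convex_closedBall (WithLp.toLp 2 y) δ).is_linear_preimage
    (f := (WithLp.toLp 2 : (Fin k → ℝ) → EuclideanSpace ℝ (Fin k))) ⟨fun _ _ => rfl, fun _ _ => rfl⟩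
  have heq : l2ball y δ = WithLp.toLp 2 ⁻¹' Metric.closedBall (WithLp.toLp 2 y) δ := by
    ext z
    simp [l2ball, l2norm_eq_norm_toLp, dist_eq_norm]
  rwa [heq]

theorem isClosed_l2ball (y : Fin k → ℝ) (δ : ℝ) : IsClosed (l2ball y δ) :=
  isClosed_le (continuous_l2norm.comp (continuous_id.sub continuous_const)) continuous_const

theorem convex_orthant (n : ℕ) : Convex ℝ (orthant n) := convex_Ici (0 : Fin n → ℝ)

theorem isClosed_orthant (n : ℕ) : IsClosed (orthant n) := isClosed_Ici (a := (0 : Fin n → ℝ))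

theorem ballProj_mem {y : Fin k → ℝ} {δ : ℝ} (hδ : 0 ≤ δ) (ν : Fin k → ℝ) :
    ballProj y δ ν ∈ l2ball y δ := by
  unfold ballProj
  split_ifs with h
  · exact h
  · have hN : 0 < l2norm (ν - y) := hδ.trans_lt (not_le.1 h)
    have h1 : l2norm (y + (δ / l2norm (ν - y)) • (ν - y) - y) = δ := by
      rw [add_sub_cancel_left, l2norm_eq_norm_toLp, WithLp.toLp_smul, norm_smul,
        ← l2norm_eq_norm_toLp, Real.norm_of_nonneg (by positivity), div_mul_cancel₀ _ hN.ne']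
    exact h1.le

/-- Outside the ball, with `w = ν - y` and `N = ‖w‖ > δ`, the first factor is a nonpositive multiple
of `w`, and Cauchy–Schwarz gives `w ⬝ᵥ (v - y) ≤ N δ`, the value attained at the projection. -/
theorem ballProj_variational {y : Fin k → ℝ} {δ : ℝ} (hδ : 0 ≤ δ) (ν : Fin k → ℝ)
    {v : Fin k → ℝ} (hv : v ∈ l2ball y δ) :
    0 ≤ (ballProj y δ ν - ν) ⬝ᵥ (v - ballProj y δ ν) := by
  unfold ballProj
  split_ifs with h
  · simp
  · have hN : 0 < l2norm (ν - y) := hδ.trans_lt (not_le.1 h)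
    set w := ν - y with hw
    set N := l2norm w with hNw
    have e1 : y + (δ / N) • w - ν = -((1 - δ / N) • w) := by
      rw [hw]; module
    have e2 : v - (y + (δ / N) • w) = (v - y) - (δ / N) • w := by module
    have hsq : w ⬝ᵥ w = N ^ 2 := (l2norm_sq w).symm
    have hcs : w ⬝ᵥ (v - y) ≤ N * δ :=
      (dotProduct_le_l2norm_mul_l2norm _ _).trans (mul_le_mul_of_nonneg_left hv hN.le)
    have hc : 0 ≤ 1 - δ / N := by
      rw [sub_nonneg, div_le_one hN]; exact (not_le.1 h).le
    rw [e1, e2, neg_dotProduct, smul_dotProduct, dotProduct_sub, dotProduct_smul, hsq]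
    simp only [smul_eq_mul]
    have : δ / N * N ^ 2 = N * δ := by field_simp
    rw [this, ← mul_neg]
    exact mul_nonneg hc (by linarith)

/-- Makes nonnegative soft thresholding the projection of `ν - τ 1` onto the orthant. -/
theorem max_zero_soft {τ : ℝ} (hτ : 0 ≤ τ) (a : ℝ) : max 0 (soft a τ) = max 0 (a - τ) := by
  unfold soft
  rcases lt_trichotomy a 0 with h | h | h
  · rw [Real.sign_of_neg h, max_eq_left, max_eq_left] <;>
      nlinarith [le_max_right (|a| - τ) 0]
  · simp [h, hτ]
  · rw [Real.sign_of_pos h, abs_of_pos h, one_mul, max_comm (a - τ), ← max_assoc, max_self]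

theorem nonnegSoft_mem (ν : Fin n → ℝ) (τ : ℝ) : nonnegSoft ν τ ∈ orthant n :=
  fun _ => le_max_left _ _

/-- Coordinatewise: the term vanishes if `ν i ≥ τ`; otherwise the update is `0` and the term is `(τ
- ν i) * v i`. -/
theorem nonnegSoft_variational {τ : ℝ} (hτ : 0 ≤ τ) (ν : Fin n → ℝ) {v : Fin n → ℝ}
    (hv : v ∈ orthant n) :
    0 ≤ (nonnegSoft ν τ - ν) ⬝ᵥ (v - nonnegSoft ν τ) + τ * ∑ i, (v i - nonnegSoft ν τ i) := by
  rw [dotProduct, Finset.mul_sum, ← Finset.sum_add_distrib]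
  refine Finset.sum_nonneg fun i _ => ?_
  simp only [Pi.sub_apply, nonnegSoft, max_zero_soft hτ]
  rcases le_total 0 (ν i - τ) with h | h
  · rw [max_eq_right h]
    apply le_of_eq; ring
  · rw [max_eq_left h]
    nlinarith [hv i]

theorem argminSet_ball (y : Fin k → ℝ) {δ : ℝ} (hδ : 0 ≤ δ) (ν : Fin k → ℝ) :
    argminSet (fun u => ((1 / 2 * l2norm (u - ν) ^ 2 : ℝ) : EReal) + indic (l2ball y δ) u) =
      {ballProj y δ ν} := by
  refine argminSet_eq_singleton_of_real (S := l2ball y δ)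
    (g := fun u => 1 / 2 * l2norm (u - ν) ^ 2) (fun z hz => by simp [indic_of_mem hz])
    (fun z hz => by rw [indic_of_notMem hz, EReal.coe_add_top]) (ballProj_mem hδ ν)
    fun z hz hne => ?_
  have h1 := l2norm_sub_sq_eq z (ballProj y δ ν) ν
  have h2 := ballProj_variational hδ ν hz
  have h3 := l2norm_sub_sq_pos hne
  linarith

theorem argminSet_nonnegSoft {τ : ℝ} (hτ : 0 ≤ τ) (ν : Fin n → ℝ) :
    argminSet (fun u => ((1 / 2 * l2norm (u - ν) ^ 2 + τ * l1norm u : ℝ) : EReal) +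
      indic (orthant n) u) = {nonnegSoft ν τ} := by
  refine argminSet_eq_singleton_of_real (S := orthant n)
    (g := fun u => 1 / 2 * l2norm (u - ν) ^ 2 + τ * l1norm u)
    (fun z hz => by rw [indic_of_mem hz, add_zero])
    (fun z hz => by rw [indic_of_notMem hz, EReal.coe_add_top]) (nonnegSoft_mem ν τ)
    fun z hz hne => ?_
  have h1 := l2norm_sub_sq_eq z (nonnegSoft ν τ) ν
  have h2 := nonnegSoft_variational hτ ν hz
  have h3 := l2norm_sub_sq_pos hne
  rw [l1norm_eq_sum hz, l1norm_eq_sum (nonnegSoft_mem ν τ)]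
  rw [Finset.sum_sub_distrib, mul_sub] at h2
  linarith

end Prox

/-! ### The splitting -/

section Splitting

variable {k n : ℕ}

/-- The effective domain of `f₂`. -/
def csDom (k n : ℕ) (y : Fin k → ℝ) (δ : ℝ) : Set (Fin k ⊕ Fin n → ℝ) :=
  {u | u ∘ Sum.inl ∈ l2ball y δ ∧ u ∘ Sum.inr ∈ orthant n}

theorem csF1_of_sum_eq {x : Fin n → ℝ} (h : ∑ i, x i = 1) : csF1 x = 0 := indic_of_mem h

theorem csF1_of_sum_ne {x : Fin n → ℝ} (h : ∑ i, x i ≠ 1) : csF1 x = ⊤ := indic_of_notMem h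

theorem csF2_of_mem {y : Fin k → ℝ} {δ lam : ℝ} {u : Fin k ⊕ Fin n → ℝ} (h : u ∈ csDom k n y δ) :
    csF2 y δ lam u = ((lam * ∑ i, u (Sum.inr i) : ℝ) : EReal) := by
  rw [csF2, indic_of_mem h.1, indic_of_mem h.2, zero_add, add_zero, l1norm_eq_sum h.2]
  rfl

theorem csF2_of_notMem {y : Fin k → ℝ} {δ lam : ℝ} {u : Fin k ⊕ Fin n → ℝ}
    (h : u ∉ csDom k n y δ) : csF2 y δ lam u = ⊤ := by
  rw [csF2]
  by_cases h1 : u ∘ Sum.inl ∈ l2ball y δ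
  · have h2 : u ∘ Sum.inr ∉ orthant n := fun h2 => h ⟨h1, h2⟩
    rw [indic_of_mem h1, indic_of_notMem h2, zero_add, EReal.coe_add_top]
  · rw [indic_of_notMem h1, EReal.top_add_coe]
    by_cases h2 : u ∘ Sum.inr ∈ orthant n
    · rw [indic_of_mem h2, add_zero]
    · rw [indic_of_notMem h2, EReal.top_add_top]

theorem convex_csDom (y : Fin k → ℝ) (δ : ℝ) : Convex ℝ (csDom k n y δ) :=
  ((convex_l2ball y δ).is_linear_preimage
    (f := fun u : Fin k ⊕ Fin n → ℝ => u ∘ Sum.inl) ⟨fun _ _ => rfl, fun _ _ => rfl⟩).inter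
  ((convex_orthant n).is_linear_preimage
    (f := fun u : Fin k ⊕ Fin n → ℝ => u ∘ Sum.inr) ⟨fun _ _ => rfl, fun _ _ => rfl⟩)

theorem isClosed_csDom (y : Fin k → ℝ) (δ : ℝ) : IsClosed (csDom k n y δ) :=
  ((isClosed_l2ball y δ).preimage
    (f := fun u : Fin k ⊕ Fin n → ℝ => u ∘ Sum.inl) (by fun_prop)).inter
  ((isClosed_orthant n).preimage
    (f := fun u : Fin k ⊕ Fin n → ℝ => u ∘ Sum.inr) (by fun_prop))

theorem isClosedProperConvex_csF1 (hn : 0 < n) : IsClosedProperConvex (csF1 (n := n)) := by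
  have hepi : {p : (Fin n → ℝ) × ℝ | csF1 p.1 ≤ (p.2 : EReal)} =
      {x : Fin n → ℝ | ∑ i, x i = 1} ×ˢ Set.Ici (0 : ℝ) := by
    ext p
    by_cases h : ∑ i, p.1 i = 1
    · simp [csF1_of_sum_eq h, h]
    · simp [csF1_of_sum_ne h, h]
  constructor
  · intro x
    by_cases h : ∑ i, x i = 1
    · simp [csF1_of_sum_eq h]
    · simp [csF1_of_sum_ne h]
  · refine ⟨Pi.single ⟨0, hn⟩ 1, ?_⟩
    rw [csF1_of_sum_eq (by simp)]
    exact EReal.zero_ne_top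
  · rw [hepi]
    refine Convex.prod ?_ (convex_Ici 0)
    intro x hx z hz a b _ _ hab
    simp only [Set.mem_ofPred_eq] at *
    simp [Finset.sum_add_distrib, ← Finset.mul_sum, hx, hz, hab]
  · rw [hepi]
    exact (isClosed_eq (by fun_prop) continuous_const).prod isClosed_Ici

theorem isClosedProperConvex_csF2 (y : Fin k → ℝ) {δ : ℝ} (hδ : 0 ≤ δ) (lam : ℝ) :
    IsClosedProperConvex (csF2 (k := k) (n := n) y δ lam) := by
  have hepi : {p : (Fin k ⊕ Fin n → ℝ) × ℝ | csF2 y δ lam p.1 ≤ (p.2 : EReal)} =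
      Prod.fst ⁻¹' csDom k n y δ ∩ {p | lam * ∑ i, p.1 (Sum.inr i) ≤ p.2} := by
    ext p
    by_cases h : p.1 ∈ csDom k n y δ
    · simp only [Set.mem_ofPred_eq, csF2_of_mem h, EReal.coe_le_coe_iff]
      simp [h]
    · simp [csF2_of_notMem h, h]
  constructor
  · intro u
    by_cases h : u ∈ csDom k n y δ
    · rw [csF2_of_mem h]; exact EReal.coe_ne_bot _
    · simp [csF2_of_notMem h]
  · refine ⟨Sum.elim y 0, ?_⟩
    rw [csF2_of_mem]
    · exact EReal.coe_ne_top _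
    · refine ⟨?_, fun i => by simp⟩
      simpa [l2ball, l2norm] using hδ
  · rw [hepi]
    refine ((convex_csDom y δ).is_linear_preimage (f := Prod.fst)
      ⟨fun _ _ => rfl, fun _ _ => rfl⟩).inter ?_
    intro p hp q hq a b ha hb _
    simp only [Set.mem_ofPred_eq] at *
    have h1 := mul_le_mul_of_nonneg_left hp ha
    have h2 := mul_le_mul_of_nonneg_left hq hb
    simp only [Prod.fst_add, Prod.smul_fst, Pi.add_apply, Pi.smul_apply, smul_eq_mul,
      Prod.snd_add, Prod.smul_snd, Finset.sum_add_distrib, ← Finset.mul_sum]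
    linarith
  · rw [hepi]
    exact ((isClosed_csDom y δ).preimage continuous_fst).inter
      (isClosed_le (by fun_prop) (by fun_prop))

theorem csG_mulVec (A : Matrix (Fin k) (Fin n) ℝ) (x : Fin n → ℝ) :
    csG A *ᵥ x = Sum.elim (A *ᵥ x) x := by
  rw [csG, fromRows_mulVec, one_mulVec]

theorem rank_csG (A : Matrix (Fin k) (Fin n) ℝ) : (csG A).rank = n := by
  have hinj : Function.Injective (csG A).mulVecLin := fun x z h => by
    simp only [mulVecLin_apply, csG_mulVec] at h
    exact funext fun i => congrFun h (Sum.inr i)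
  rw [Matrix.rank, LinearMap.finrank_range_of_inj hinj, Module.finrank_fin_fun]

/-! ### The feasible set consists of solutions -/

theorem cbpdnSolutions_eq_feasible (A : Matrix (Fin k) (Fin n) ℝ) (y : Fin k → ℝ) (δ : ℝ) :
    cbpdnSolutions A y δ = cbpdnFeasible A y δ := by
  have h1 : ∀ x ∈ cbpdnFeasible A y δ, l1norm x = 1 := fun x hx => by
    rw [l1norm_eq_sum hx.2.1, hx.2.2]
  ext x
  refine ⟨fun h => h.1, fun h => ⟨h, fun z hz => ?_⟩⟩
  simp only [Set.mem_ofPred_eq]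
  rw [h1 x h, h1 z hz]

theorem cbpFeasible_eq (A : Matrix (Fin k) (Fin n) ℝ) (y : Fin k → ℝ) :
    cbpFeasible A y = cbpdnFeasible A y 0 := by
  ext x
  simp only [cbpFeasible, cbpdnFeasible, Set.mem_ofPred_eq, (l2norm_nonneg _).ge_iff_eq',
    l2norm_eq_zero, sub_eq_zero]

theorem cbpSolutions_eq (A : Matrix (Fin k) (Fin n) ℝ) (y : Fin k → ℝ) :
    cbpSolutions A y = cbpdnSolutions A y 0 := by
  rw [cbpSolutions, cbpdnSolutions, cbpFeasible_eq]

theorem mem_cbpdnFeasible_iff {A : Matrix (Fin k) (Fin n) ℝ} {y : Fin k → ℝ} {δ : ℝ}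
    {x : Fin n → ℝ} :
    x ∈ cbpdnFeasible A y δ ↔ csG A *ᵥ x ∈ csDom k n y δ ∧ ∑ i, x i = 1 := by
  rw [csG_mulVec]
  exact and_assoc.symm

/-- The objective is constantly `lam` on the feasible set and `⊤` off it. If nothing is feasible,
both sides are empty, because `argminSet` excludes the value `⊤`. -/
theorem cbpdnFeasible_eq_argminSet (A : Matrix (Fin k) (Fin n) ℝ) (y : Fin k → ℝ)
    (δ lam : ℝ) : cbpdnFeasible A y δ =
      argminSet (fun x => csF1 x + csF2 y δ lam (csG A *ᵥ x)) := by
  have hin : ∀ x ∈ cbpdnFeasible A y δ, csF1 x + csF2 y δ lam (csG A *ᵥ x) = (lam : EReal) :=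
    fun x hx => by
      obtain ⟨h1, h2⟩ := mem_cbpdnFeasible_iff.1 hx
      rw [csF1_of_sum_eq h2, csF2_of_mem h1, zero_add]
      simp [csG_mulVec, h2]
  have hout : ∀ x ∉ cbpdnFeasible A y δ, csF1 x + csF2 y δ lam (csG A *ᵥ x) = ⊤ := fun x hx => by
    by_cases h2 : ∑ i, x i = 1
    · rw [csF1_of_sum_eq h2, csF2_of_notMem fun h1 => hx (mem_cbpdnFeasible_iff.2 ⟨h1, h2⟩),
        zero_add]
    · rw [csF1_of_sum_ne h2]
      by_cases h1 : csG A *ᵥ x ∈ csDom k n y δ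
      · rw [csF2_of_mem h1, EReal.top_add_coe]
      · rw [csF2_of_notMem h1, EReal.top_add_top]
  ext x
  constructor
  · intro hx
    refine ⟨by simp [hin x hx], fun z => ?_⟩
    by_cases hz : z ∈ cbpdnFeasible A y δ
    · dsimp only
      rw [hin x hx, hin z hz]
    · simp [hout z hz]
  · rintro ⟨h, -⟩
    by_contra hx
    exact h (hout x hx)

/-! ### The updates -/

theorem posDef_csB (A : Matrix (Fin k) (Fin n) ℝ) : (csB A).PosDef := by
  rw [csB, add_comm, ← conjTranspose_eq_transpose_of_trivial]
  exact PosDef.one.add_posSemidef (posSemidef_conjTranspose_mul_self A)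

theorem one_dotProduct_inv_csB_pos (hn : 0 < n) (A : Matrix (Fin k) (Fin n) ℝ) :
    0 < (1 : Fin n → ℝ) ⬝ᵥ (csB A)⁻¹ *ᵥ 1 := by
  have h : (1 : Fin n → ℝ) ≠ 0 := fun h => one_ne_zero (congrFun h ⟨0, hn⟩)
  simpa using (posDef_csB A).inv.dotProduct_mulVec_pos h

/-- The vector `csC A` has coordinate sum `1`, so the correction removes exactly the excess of the
sum over `1`. -/
theorem sum_csXUpdate (hn : 0 < n) (A : Matrix (Fin k) (Fin n) ℝ) (u₁ d₁ : Fin k → ℝ)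
    (u₂ d₂ : Fin n → ℝ) : ∑ i, csXUpdate A u₁ d₁ u₂ d₂ i = 1 := by
  have h := (one_dotProduct_inv_csB_pos hn A).ne'
  rw [← one_dotProduct]
  simp only [csXUpdate, csC, dotProduct_sub, dotProduct_smul, smul_eq_mul]
  rw [inv_mul_cancel₀ h]
  ring

/-- The optimality condition of the `x`-update. -/
theorem csXUpdate_variational (hn : 0 < n) (A : Matrix (Fin k) (Fin n) ℝ) (u₁ d₁ : Fin k → ℝ)
    (u₂ d₂ : Fin n → ℝ) {z : Fin n → ℝ} (hz : ∑ i, z i = 1) :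
    (csG A *ᵥ csXUpdate A u₁ d₁ u₂ d₂ - Sum.elim u₁ u₂ - Sum.elim d₁ d₂) ⬝ᵥ
      (csG A *ᵥ z - csG A *ᵥ csXUpdate A u₁ d₁ u₂ d₂) = 0 := by
  set x := csXUpdate A u₁ d₁ u₂ d₂ with hx
  have hdet : IsUnit (csB A).det := (isUnit_iff_isUnit_det _).1 (posDef_csB A).isUnit
  -- Here `c` is the Lagrange multiplier of the sum constraint; the residual is a multiple of `1`,
  -- orthogonal to zero-sum directions.
  obtain ⟨c, hc⟩ : ∃ c : ℝ, csB A *ᵥ x = Aᵀ *ᵥ (u₁ + d₁) + (u₂ + d₂) - c • 1 := by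
    rw [hx]
    simp only [csXUpdate, csC, mulVec_sub, mulVec_smul, mulVec_mulVec, mul_nonsing_inv _ hdet,
      one_mulVec, smul_smul]
    exact ⟨_, rfl⟩
  have h1 : (1 : Fin n → ℝ) ⬝ᵥ (z - x) = 0 := by
    rw [dotProduct_sub, one_dotProduct, one_dotProduct, hz, sum_csXUpdate hn, sub_self]
  have hT : ∀ (v : Fin k → ℝ) (w : Fin n → ℝ), v ⬝ᵥ A *ᵥ w = (Aᵀ *ᵥ v) ⬝ᵥ w := fun v w => by
    rw [dotProduct_mulVec, mulVec_transpose]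
  have h2 : (csG A *ᵥ x - Sum.elim u₁ u₂ - Sum.elim d₁ d₂) ⬝ᵥ (csG A *ᵥ z - csG A *ᵥ x) =
      (csB A *ᵥ x - (Aᵀ *ᵥ (u₁ + d₁) + (u₂ + d₂))) ⬝ᵥ (z - x) := by
    rw [← mulVec_sub, csG_mulVec, csG_mulVec, csB, add_mulVec, one_mulVec, ← mulVec_mulVec,
      mulVec_add, ← Sum.elim_sub_sub, ← Sum.elim_sub_sub, sumElim_dotProduct_sumElim, hT]
    simp only [mulVec_sub, ← add_dotProduct]
    congr 1
    abel
  rw [h2, hc, sub_sub_cancel_left, neg_dotProduct, smul_dotProduct, h1, smul_zero, neg_zero]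

theorem argminSet_admmObjX (hn : 0 < n) (A : Matrix (Fin k) (Fin n) ℝ) {μ : ℝ} (hμ : 0 < μ)
    (u₁ d₁ : Fin k → ℝ) (u₂ d₂ : Fin n → ℝ) :
    argminSet (admmObjX csF1 (csG A) μ (Sum.elim u₁ u₂) (Sum.elim d₁ d₂)) =
      {csXUpdate A u₁ d₁ u₂ d₂} := by
  refine argminSet_eq_singleton_of_real (S := {x | ∑ i, x i = 1})
    (g := fun x => μ / 2 * l2norm (csG A *ᵥ x - Sum.elim u₁ u₂ - Sum.elim d₁ d₂) ^ 2)
    (fun z hz => by rw [admmObjX, csF1_of_sum_eq hz, zero_add])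
    (fun z hz => by rw [admmObjX, csF1_of_sum_ne hz, EReal.top_add_coe])
    (sum_csXUpdate hn A _ _ _ _) fun z hz hne => ?_
  have h1 := csXUpdate_variational hn A u₁ d₁ u₂ d₂ hz
  -- The identity block makes `G` injective, so strictness in `G x` gives strictness in `x`.
  have hne' : csG A *ᵥ z ≠ csG A *ᵥ csXUpdate A u₁ d₁ u₂ d₂ := fun h => hne <| by
    rw [csG_mulVec, csG_mulVec] at h
    exact funext fun i => congrFun h (Sum.inr i)
  have h2 := l2norm_sub_sq_pos hne'
  have h3 := l2norm_sub_sq_eq (csG A *ᵥ z) (csG A *ᵥ csXUpdate A u₁ d₁ u₂ d₂)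
    (Sum.elim u₁ u₂ + Sum.elim d₁ d₂)
  simp only [← sub_sub] at h3
  refine mul_lt_mul_of_pos_left ?_ (by positivity)
  linarith

/-- The optimality condition of the `u`-update. -/
theorem csUUpdate_variational (y : Fin k → ℝ) {δ τ : ℝ} (hδ : 0 ≤ δ) (hτ : 0 ≤ τ)
    (t₁ : Fin k → ℝ) (t₂ : Fin n → ℝ) {v : Fin k ⊕ Fin n → ℝ} (hv : v ∈ csDom k n y δ) :
    0 ≤ (Sum.elim (ballProj y δ t₁) (nonnegSoft t₂ τ) - Sum.elim t₁ t₂ +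
      Sum.elim (0 : Fin k → ℝ) fun _ : Fin n => τ) ⬝ᵥ
      (v - Sum.elim (ballProj y δ t₁) (nonnegSoft t₂ τ)) := by
  have h1 := ballProj_variational hδ t₁ hv.1
  have h2 := nonnegSoft_variational hτ t₂ hv.2
  simp only [dotProduct, Pi.sub_apply, Pi.add_apply, Fintype.sum_sum_type, Sum.elim_inl,
    Sum.elim_inr, Pi.zero_apply, zero_mul, Finset.sum_const_zero, zero_add, add_mul, Finset.sum_add_distrib, Finset.mul_sum,
    Function.comp_apply] at *
  linarith

theorem argminSet_admmObjU (A : Matrix (Fin k) (Fin n) ℝ) (y : Fin k → ℝ) {δ lam μ : ℝ}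
    (hδ : 0 ≤ δ) (hlam : 0 ≤ lam) (hμ : 0 < μ) (x : Fin n → ℝ) (d₁ : Fin k → ℝ)
    (d₂ : Fin n → ℝ) :
    argminSet (admmObjU (csF2 y δ lam) (csG A) μ x (Sum.elim d₁ d₂)) =
      {Sum.elim (ballProj y δ (A *ᵥ x - d₁)) (nonnegSoft (x - d₂) (lam / μ))} := by
  refine argminSet_eq_singleton_of_real (S := csDom k n y δ)
    (g := fun u => lam * ∑ i, u (Sum.inr i) +
      μ / 2 * l2norm (csG A *ᵥ x - u - Sum.elim d₁ d₂) ^ 2)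
    (fun z hz => by rw [admmObjU, csF2_of_mem hz, EReal.coe_add])
    (fun z hz => by rw [admmObjU, csF2_of_notMem hz, EReal.top_add_coe])
    ⟨ballProj_mem hδ _, nonnegSoft_mem _ _⟩ fun z hz hne => ?_
  have ht : ∀ u : Fin k ⊕ Fin n → ℝ, l2norm (csG A *ᵥ x - u - Sum.elim d₁ d₂) =
      l2norm (u - Sum.elim (A *ᵥ x - d₁) (x - d₂)) := fun u => by
    rw [sub_right_comm, l2norm_sub_comm, csG_mulVec, ← Sum.elim_sub_sub]
  set q : Fin k ⊕ Fin n → ℝ :=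
    Sum.elim (ballProj y δ (A *ᵥ x - d₁)) (nonnegSoft (x - d₂) (lam / μ)) with hq
  have h1 := csUUpdate_variational y hδ (div_nonneg hlam hμ.le) (A *ᵥ x - d₁) (x - d₂) hz
  rw [← hq, add_dotProduct] at h1
  have h2 := l2norm_sub_sq_pos hne
  have h3 := l2norm_sub_sq_eq z q (Sum.elim (A *ᵥ x - d₁) (x - d₂))
  have h4 : (Sum.elim (0 : Fin k → ℝ) fun _ : Fin n => lam / μ) ⬝ᵥ (z - q) =
      lam / μ * (∑ i, z (Sum.inr i) - ∑ i, q (Sum.inr i)) := by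
    simp [dotProduct, Fintype.sum_sum_type, ← Finset.mul_sum, Finset.sum_sub_distrib]
  rw [h4] at h1
  -- Scaling by `μ` turns the threshold `lam / μ` back into the weight `lam` of the objective.
  have h5 := mul_nonneg hμ.le h1
  rw [mul_add, ← mul_assoc, mul_div_cancel₀ _ hμ.ne'] at h5
  have h6 := mul_pos hμ h2
  rw [ht, ht, h3]
  linarith

theorem isCSUnSAL_iff_isADMM (hn : 0 < n) (A : Matrix (Fin k) (Fin n) ℝ) (y : Fin k → ℝ)
    {δ lam μ : ℝ} (hδ : 0 ≤ δ) (hlam : 0 ≤ lam) (hμ : 0 < μ) (x : ℕ → Fin n → ℝ)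
    (u₁ d₁ : ℕ → Fin k → ℝ) (u₂ d₂ : ℕ → Fin n → ℝ) :
    IsCSUnSAL A y δ lam μ x u₁ d₁ u₂ d₂ ↔
      IsADMM csF1 (csF2 y δ lam) (csG A) μ x
        (fun j => Sum.elim (u₁ j) (u₂ j)) (fun j => Sum.elim (d₁ j) (d₂ j)) := by
  have hinj : ∀ {a a' : Fin k → ℝ} {b b' : Fin n → ℝ},
      Sum.elim a b = Sum.elim a' b' ↔ a = a' ∧ b = b' := Sum.elim_eq_iff
  constructor
  · intro h
    refine ⟨fun j => ?_, fun j => ?_, fun j => ?_⟩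
    · rw [argminSet_admmObjX hn A hμ]; exact h.x_step j
    · rw [argminSet_admmObjU A y hδ hlam hμ]
      exact hinj.2 ⟨h.u₁_step j, h.u₂_step j⟩
    · rw [csG_mulVec, ← Sum.elim_sub_sub, ← Sum.elim_sub_sub]
      exact hinj.2 ⟨h.d₁_step j, h.d₂_step j⟩
  · rintro ⟨hx, hu, hd⟩
    simp only [argminSet_admmObjX hn A hμ, argminSet_admmObjU A y hδ hlam hμ, csG_mulVec,
      ← Sum.elim_sub_sub, Set.mem_singleton_iff, hinj] at hx hu hd
    exact ⟨hx, fun j => (hu j).1, fun j => (hu j).2, fun j => (hd j).1, fun j => (hd j).2⟩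

/-! ### Convergence -/

theorem IsCSUnSAL.tendsto (hn : 0 < n) {A : Matrix (Fin k) (Fin n) ℝ} {y : Fin k → ℝ}
    {δ lam μ : ℝ} (hδ : 0 ≤ δ) (hlam : 0 ≤ lam) (hμ : 0 < μ) {x : ℕ → Fin n → ℝ}
    {u₁ d₁ : ℕ → Fin k → ℝ} {u₂ d₂ : ℕ → Fin n → ℝ} (h : IsCSUnSAL A y δ lam μ x u₁ d₁ u₂ d₂)
    (hne : (cbpdnFeasible A y δ).Nonempty) :
    ∃ xs ∈ cbpdnFeasible A y δ, Tendsto x atTop (𝓝 xs) := by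
  set τ := lam / μ with hτ
  have hτ0 : 0 ≤ τ := div_nonneg hlam hμ.le
  let T : (Fin k ⊕ Fin n → ℝ) → EuclideanSpace ℝ (Fin k ⊕ Fin n) := WithLp.toLp 2
  -- The dual shift that absorbs the linear penalty.
  let s : Fin k ⊕ Fin n → ℝ := Sum.elim 0 fun _ => τ
  have hin : ∀ v w, inner ℝ (T v) (T w) = v ⬝ᵥ w := fun v w => by
    rw [EuclideanSpace.inner_toLp_toLp, dotProduct_comm]; simp
  -- The preimage `x` of a point of `L` is its second block, so `L` is cut out by continuous
  -- equations and its closedness is immediate.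
  let L : Set (EuclideanSpace ℝ (Fin k ⊕ Fin n)) :=
    {v | ∑ i, v (Sum.inr i) = 1 ∧ v = T (csG A *ᵥ fun i => v (Sum.inr i))}
  let C : Set (EuclideanSpace ℝ (Fin k ⊕ Fin n)) := {v | v.ofLp ∈ csDom k n y δ}
  have hTL : ∀ z : Fin n → ℝ, ∑ i, z i = 1 → T (csG A *ᵥ z) ∈ L := fun z hz => by
    simp [L, T, csG_mulVec, hz]
  have hLT : ∀ v ∈ L, ∃ z : Fin n → ℝ, ∑ i, z i = 1 ∧ v = T (csG A *ᵥ z) := fun v hv =>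
    ⟨_, hv.1, hv.2⟩
  have hxsum : ∀ j, ∑ i, x (j + 1) i = 1 := fun j => by rw [h.x_step j, sum_csXUpdate hn]
  have hcontG : Continuous fun z : Fin n → ℝ => csG A *ᵥ z :=
    (csG A).mulVecLin.continuous_of_finiteDimensional
  have hLc : IsClosed L := by
    refine (isClosed_eq (by fun_prop) continuous_const).inter (isClosed_eq continuous_id ?_)
    exact (PiLp.continuous_toLp 2 _).comp (hcontG.comp (by fun_prop))
  have hCc : IsClosed C := (isClosed_csDom y δ).preimage (PiLp.continuous_ofLp 2 _)
  have hd : ∀ j, (Sum.elim (d₁ (j + 1)) (d₂ (j + 1)) : Fin k ⊕ Fin n → ℝ) =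
      Sum.elim (d₁ j) (d₂ j) - (csG A *ᵥ x (j + 1) - Sum.elim (u₁ (j + 1)) (u₂ (j + 1))) :=
    ((isCSUnSAL_iff_isADMM hn A y hδ hlam hμ x u₁ d₁ u₂ d₂).1 h).d_step
  have key : ∃ p ∈ L ∩ C, Tendsto (fun j => T (csG A *ᵥ x (j + 1))) atTop (𝓝 p) := by
    refine tendsto_of_alternating_projections hLc hCc
      (u := fun j => T (Sum.elim (u₁ j) (u₂ j)))
      (e := fun j => T (Sum.elim (d₁ j) (d₂ j) + s)) ?_ (fun j => hTL _ (hxsum j)) ?_ ?_ ?_ ?_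
    · obtain ⟨z, hz⟩ := hne
      obtain ⟨h1, h2⟩ := mem_cbpdnFeasible_iff.1 hz
      exact ⟨_, hTL z h2, h1⟩
    · intro j v hv
      obtain ⟨z, hz, rfl⟩ := hLT v hv
      have h1 := csXUpdate_variational hn A (u₁ j) (d₁ j) (u₂ j) (d₂ j) hz
      rw [← h.x_step j] at h1
      -- Both second blocks have sum `1`, so the shift does not alter the projection onto `L`.
      have h2 : s ⬝ᵥ (csG A *ᵥ z - csG A *ᵥ x (j + 1)) = 0 := by
        simp [s, csG_mulVec, dotProduct, Fintype.sum_sum_type, ← Finset.mul_sum, hz, hxsum j]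
      refine (hin (csG A *ᵥ x (j + 1) - Sum.elim (u₁ j) (u₂ j) - (Sum.elim (d₁ j) (d₂ j) + s))
        (csG A *ᵥ z - csG A *ᵥ x (j + 1))).trans ?_
      rw [← sub_sub, sub_dotProduct, h1, h2, sub_zero]
    · intro j
      change Sum.elim (u₁ (j + 1)) (u₂ (j + 1)) ∈ csDom k n y δ
      rw [h.u₁_step j, h.u₂_step j]
      exact ⟨ballProj_mem hδ _, nonnegSoft_mem _ _⟩
    · intro j v hv
      have h1 := csUUpdate_variational y hδ hτ0 (A *ᵥ x (j + 1) - d₁ j) (x (j + 1) - d₂ j) hv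
      rw [← h.u₁_step j, ← h.u₂_step j] at h1
      refine h1.trans_eq (Eq.trans ?_ (hin (Sum.elim (d₁ (j + 1)) (d₂ (j + 1)) + s)
        (v.ofLp - Sum.elim (u₁ (j + 1)) (u₂ (j + 1)))).symm)
      -- The shifted dual `d (j + 1) + s` equals `u (j + 1) - (G x (j + 1) - d j) + s`, the vector
      -- in the optimality condition of the `u`-update.
      rw [hd j, csG_mulVec, Sum.elim_sub_sub]
      congr 2
      abel
    · intro j
      change T (Sum.elim (d₁ (j + 1)) (d₂ (j + 1)) + s) =
        T (Sum.elim (d₁ j) (d₂ j) + s - (csG A *ᵥ x (j + 1) - Sum.elim (u₁ (j + 1)) (u₂ (j + 1))))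
      rw [hd j, add_sub_right_comm]
  obtain ⟨p, ⟨hpL, hpC⟩, hp⟩ := key
  obtain ⟨z, hz, rfl⟩ := hLT p hpL
  refine ⟨z, mem_cbpdnFeasible_iff.2 ⟨hpC, hz⟩, (tendsto_add_atTop_iff_nat 1).1 ?_⟩
  -- Reading off the second block recovers `x` from `G x`.
  have hc : Continuous fun (v : EuclideanSpace ℝ (Fin k ⊕ Fin n)) (i : Fin n) =>
      v (Sum.inr i) := by fun_prop
  have := (hc.tendsto _).comp hp
  simpa [T, csG_mulVec, Function.comp_def] using this

end Splitting

theorem mainTheorem2 {k n : ℕ} (hn : 0 < n) (A : Matrix (Fin k) (Fin n) ℝ) (y : Fin k → ℝ)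
    (δ lam μ : ℝ) (hδ : 0 ≤ δ) (hlam : 0 ≤ lam) (hμ : 0 < μ) :
    -- CBPDN is the unconstrained problem `min f₁(x) + f₂(G x)`; CBP is the case `δ = 0`
    cbpdnSolutions A y δ = argminSet (fun x => csF1 x + csF2 y δ lam (csG A *ᵥ x)) ∧
    cbpSolutions A y = cbpdnSolutions A y 0 ∧
    -- `f₁`, `f₂` are closed, proper, convex and `G` has full column rank
    IsClosedProperConvex (csF1 (n := n)) ∧
    IsClosedProperConvex (csF2 (k := k) (n := n) y δ lam) ∧
    (csG A).rank = n ∧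
    -- the closed-form `x`-update is well defined and solves the equality-constrained
    -- quadratic problem
    IsUnit (csB A) ∧ (1 : Fin n → ℝ) ⬝ᵥ (csB A)⁻¹ *ᵥ 1 ≠ 0 ∧
    (∀ (u₁ d₁ : Fin k → ℝ) (u₂ d₂ : Fin n → ℝ),
      argminSet (admmObjX csF1 (csG A) μ (Sum.elim u₁ u₂) (Sum.elim d₁ d₂)) =
        {csXUpdate A u₁ d₁ u₂ d₂}) ∧
    -- the `u`-updates: projection onto the ball and nonnegative soft thresholding
    (∀ ν : Fin k → ℝ,
      argminSet (fun u => ((1 / 2 * l2norm (u - ν) ^ 2 : ℝ) : EReal) + indic (l2ball y δ) u) =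
        {ballProj y δ ν}) ∧
    (∀ ν : Fin n → ℝ,
      argminSet (fun u => ((1 / 2 * l2norm (u - ν) ^ 2 + lam / μ * l1norm u : ℝ) : EReal) +
        indic (orthant n) u) = {nonnegSoft ν (lam / μ)}) ∧
    (∀ (x : Fin n → ℝ) (d₁ : Fin k → ℝ) (d₂ : Fin n → ℝ),
      argminSet (admmObjU (csF2 y δ lam) (csG A) μ x (Sum.elim d₁ d₂)) =
        {Sum.elim (ballProj y δ (A *ᵥ x - d₁)) (nonnegSoft (x - d₂) (lam / μ))}) ∧
    -- CBPDN has a solution as soon as it is feasible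
    ((cbpdnFeasible A y δ).Nonempty → (cbpdnSolutions A y δ).Nonempty) ∧
    ∀ (x : ℕ → Fin n → ℝ) (u₁ d₁ : ℕ → Fin k → ℝ) (u₂ d₂ : ℕ → Fin n → ℝ),
      -- C-SUnSAL is ADMM for this splitting
      (IsCSUnSAL A y δ lam μ x u₁ d₁ u₂ d₂ ↔
        IsADMM csF1 (csF2 y δ lam) (csG A) μ x
          (fun j => Sum.elim (u₁ j) (u₂ j)) (fun j => Sum.elim (d₁ j) (d₂ j))) ∧
      -- convergence of C-SUnSAL, for CBPDN and for CBP
      (IsCSUnSAL A y δ lam μ x u₁ d₁ u₂ d₂ →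
        ((cbpdnSolutions A y δ).Nonempty →
          ∃ xs ∈ cbpdnSolutions A y δ, Tendsto x atTop (𝓝 xs)) ∧
        (δ = 0 → (cbpSolutions A y).Nonempty →
          ∃ xs ∈ cbpSolutions A y, Tendsto x atTop (𝓝 xs))) := by
  refine ⟨?_, cbpSolutions_eq A y, isClosedProperConvex_csF1 hn,
    isClosedProperConvex_csF2 y hδ lam, rank_csG A, (posDef_csB A).isUnit,
    (one_dotProduct_inv_csB_pos hn A).ne', argminSet_admmObjX hn A hμ, argminSet_ball y hδ,
    argminSet_nonnegSoft (div_nonneg hlam hμ.le), argminSet_admmObjU A y hδ hlam hμ, ?_,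
    fun x u₁ d₁ u₂ d₂ => ⟨isCSUnSAL_iff_isADMM hn A y hδ hlam hμ x u₁ d₁ u₂ d₂,
      fun h => ⟨?_, ?_⟩⟩⟩
  · rw [cbpdnSolutions_eq_feasible, cbpdnFeasible_eq_argminSet]
  · rw [cbpdnSolutions_eq_feasible]
    exact id
  · rw [cbpdnSolutions_eq_feasible]
    exact h.tendsto hn hδ hlam hμ
  · rintro rfl
    rw [cbpSolutions_eq, cbpdnSolutions_eq_feasible]
    exact h.tendsto hn hδ hlam hμ
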